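/- Let $\mathcal C$ be a triangulated category with suspension $\Sigma$, let $\mathcal D\subseteq\mathcal C$ be a full triangulated subcategory, and let $Q\colon\mathcal C\to\mathcal C/\mathcal D$ be the Verdier quotient functor. For objects $x,y$ of a triangulated category $\mathcal T$ write $\operatorname{Hom}^*_{\mathcal T}(x,y)=\coprod_{n\in\mathbb Z}\operatorname{Hom}_{\mathcal T}(x,\Sigma^n y)$ and $\operatorname{End}^*_{\mathcal T}(x)=\operatorname{Hom}^*_{\mathcal T}(x,x)$; the graded ring $\operatorname{End}^*_{\mathcal T}(x)$ acts on $\operatorname{Hom}^*_{\mathcal T}(x,y)$ from the right by composition. Let $c\in\mathcal C$ be an object, let $H$ be a $\mathbb Z$-graded ring that is graded commutative (that is, $ab=(-1)^{|a||b|}ba$ for homogeneous $a,b$), and let $\phi\colon H\to\operatorname{End}^*_{\mathcal C}(c)$ be a homomorphism of graded rings. Then $H$ acts from the right on $\operatorname{Hom}^*_{\mathcal C}(c,x)$ via $\phi$ and on $\operatorname{Hom}^*_{\mathcal C/\mathcal D}(c,x)$ via $\phi$ and $Q$. Fix a set $S\subseteq H$ of homogeneous elements, and for a graded $H$-module $M$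 let $S^{-1}M$ be its localization with respect to the multiplicative set generated by $S$. For each $x\in\mathcal C$ let $$\pi\colon\operatorname{Hom}^*_{\mathcal C}(c,x)\to\operatorname{Hom}^*_{\mathcal C/\mathcal D}(c,x)\qquad\text{and}\qquad \nu\colon\operatorname{Hom}^*_{\mathcal C/\mathcal D}(c,x)\to S^{-1}\operatorname{Hom}^*_{\mathcal C/\mathcal D}(c,x)$$ be the homomorphisms of graded $H$-modules given by $Q$ and by $f\mapsto f/1$, respectively. For a homogeneous element $\tau$ of degree $d$ in $\operatorname{End}^*_{\mathcal C}(c)$, regarded as a morphism $\Sigma^{-d}c\to c$, let $c/\tau$ denote its cofiber. 1. If $c/\phi(\sigma)\in\mathcal D$ for all $\sigma\in S$, then $\nu$ is an isomorphism of graded $H$-modules for every $x\in\mathcal C$. 2. If $S^{-1}\operatorname{Hom}^*_{\mathcal C}(c,y)=0$ for every $y\in\mathcal D$, then $$S^{-1}\pi\colon S^{-1}\operatorname{Hom}^*_{\mathcal C}(c,x)\to S^{-1}\operatorname{Hom}^*_{\mathcal C/\mathcal D}(c,x)$$ is an isomorphism of graded $H$-modules for every $x\in\mathcal C$. -/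

import Mathlib

open CategoryTheory Limits Pretriangulated MulOpposite
open scoped DirectSum

universe v v' u u' w

noncomputable section

namespace CohomologicalLocalization

/-! ### Graded Hom groups in a preadditive category with shift -/

section GradedHom

variable {C : Type u} [Category.{v} C] [Preadditive C] [HasShift C ℤ]

/-- `Hom*(X, Y) = ∐ n, Hom(X, Σⁿ Y)`. -/
def GradedHom (X Y : C) : Type v := ⨁ n : ℤ, ShiftedHom X Y n

instance (X Y : C) : AddCommGroup (GradedHom X Y) :=
  inferInstanceAs (AddCommGroup (⨁ n : ℤ, ShiftedHom X Y n))

/-- The inclusion of the component of degree `n`. -/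
def GradedHom.of {X Y : C} (n : ℤ) : ShiftedHom X Y n →+ GradedHom X Y :=
  DirectSum.of (fun n : ℤ => ShiftedHom X Y n) n

/-- The component of degree `n` of an element. -/
def GradedHom.component {X Y : C} (n : ℤ) (f : GradedHom X Y) : ShiftedHom X Y n :=
  (show ⨁ n : ℤ, ShiftedHom X Y n from f) n

theorem GradedHom.hom_ext {X Y : C} {A : Type*} [AddMonoid A] {F G : GradedHom X Y →+ A}
    (h : ∀ (n : ℤ) (f : ShiftedHom X Y n), F (GradedHom.of n f) = G (GradedHom.of n f)) : F = G :=
  DirectSum.addHom_ext h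

/-- The universal property of the coproduct. -/
def GradedHom.lift {X Y : C} {A : Type*} [AddCommGroup A]
    (F : ∀ n : ℤ, ShiftedHom X Y n →+ A) : GradedHom X Y →+ A :=
  DirectSum.toAddMonoid F

theorem GradedHom.lift_of {X Y : C} {A : Type*} [AddCommGroup A]
    (F : ∀ n : ℤ, ShiftedHom X Y n →+ A) (n : ℤ) (f : ShiftedHom X Y n) :
    GradedHom.lift F (GradedHom.of n f) = F n f :=
  DirectSum.toAddMonoid_of F n f

/-- The homogeneous elements of degree `n`. -/
def GradedHom.degree (X Y : C) (n : ℤ) : AddSubgroup (GradedHom X Y) :=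
  (GradedHom.of (X := X) (Y := Y) n).range

variable [∀ n : ℤ, (shiftFunctor C n).Additive]

/-- Composition `Hom*(X, Y) × Hom*(Y, Z) → Hom*(X, Z)`, given on homogeneous elements
`f : X ⟶ Σᵃ Y`, `g : Y ⟶ Σᵇ Z` by `Σᵃ g ∘ f : X ⟶ Σᵇ⁺ᵃ Z`. -/
def GradedHom.compHom (X Y Z : C) : GradedHom X Y →+ GradedHom Y Z →+ GradedHom X Z :=
  GradedHom.lift fun a => AddMonoidHom.flip <| GradedHom.lift fun b =>
    AddMonoidHom.flip <| AddMonoidHom.mk' (fun f : ShiftedHom X Y a =>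
      AddMonoidHom.mk' (fun g : ShiftedHom Y Z b =>
        GradedHom.of (b + a) (f.comp g rfl)) (fun g₁ g₂ => by simp))
      (fun f₁ f₂ => by ext g; simp)

/-- Composition in the diagrammatic order: first `f`, then `g`. -/
def GradedHom.comp {X Y Z : C} (f : GradedHom X Y) (g : GradedHom Y Z) : GradedHom X Z :=
  GradedHom.compHom X Y Z f g

theorem GradedHom.of_comp_of {X Y Z : C} {a b : ℤ} (f : ShiftedHom X Y a) (g : ShiftedHom Y Z b) :
    (GradedHom.of a f).comp (GradedHom.of b g) = GradedHom.of (b + a) (f.comp g rfl) := by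
  simp [GradedHom.comp, GradedHom.compHom, GradedHom.lift_of]

/-- The identity, in degree zero. -/
def GradedHom.id (X : C) : GradedHom X X := GradedHom.of 0 (ShiftedHom.mk₀ 0 rfl (𝟙 X))

theorem GradedHom.of_comp_of' {X Y Z : C} {a b c : ℤ} (f : ShiftedHom X Y a)
    (g : ShiftedHom Y Z b) (h : b + a = c) :
    (GradedHom.of a f).comp (GradedHom.of b g) = GradedHom.of c (f.comp g h) := by
  subst h
  exact GradedHom.of_comp_of f g

theorem GradedHom.id_comp {X Y : C} (f : GradedHom X Y) : (GradedHom.id X).comp f = f := by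
  suffices h : GradedHom.compHom X X Y (GradedHom.id X) = AddMonoidHom.id _ from
    DFunLike.congr_fun h f
  apply GradedHom.hom_ext
  intro n f
  change (GradedHom.of 0 _).comp (GradedHom.of n f) = _
  rw [GradedHom.of_comp_of' _ _ (add_zero n)]
  simp

theorem GradedHom.comp_id {X Y : C} (f : GradedHom X Y) : f.comp (GradedHom.id Y) = f := by
  suffices h : (GradedHom.compHom X Y Y).flip (GradedHom.id Y) = AddMonoidHom.id _ from
    DFunLike.congr_fun h f
  apply GradedHom.hom_ext
  intro n f
  change (GradedHom.of n f).comp (GradedHom.of 0 _) = _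
  rw [GradedHom.of_comp_of' _ _ (zero_add n)]
  simp

theorem GradedHom.comp_assoc {X Y Z T : C} (f : GradedHom X Y) (g : GradedHom Y Z)
    (h : GradedHom Z T) : (f.comp g).comp h = f.comp (g.comp h) := by
  suffices H : (AddMonoidHom.compHom (GradedHom.compHom X Z T)).comp (GradedHom.compHom X Y Z) =
      (AddMonoidHom.compHom.flip (GradedHom.compHom Y Z T)).comp
        (AddMonoidHom.compHom.comp (GradedHom.compHom X Y T)) from
    DFunLike.congr_fun (DFunLike.congr_fun (DFunLike.congr_fun H f) g) h
  apply GradedHom.hom_ext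
  intro a f
  apply GradedHom.hom_ext
  intro b g
  apply GradedHom.hom_ext
  intro c h
  change ((GradedHom.of a f).comp (GradedHom.of b g)).comp (GradedHom.of c h) =
    (GradedHom.of a f).comp ((GradedHom.of b g).comp (GradedHom.of c h))
  rw [GradedHom.of_comp_of f g, GradedHom.of_comp_of g h,
    GradedHom.of_comp_of' _ _ (show c + (b + a) = c + b + a by rw [add_assoc]),
    GradedHom.of_comp_of, ShiftedHom.comp_assoc f g h rfl rfl rfl]

/-- The graded endomorphism ring `End*(X)`, with the composition `(f * g) = f ∘ g`. -/
def GradedEnd (X : C) : Type v := GradedHom X X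

instance (X : C) : AddCommGroup (GradedEnd X) := inferInstanceAs (AddCommGroup (GradedHom X X))

instance (X : C) : Ring (GradedEnd X) :=
  { (inferInstance : AddCommGroup (GradedEnd X)) with
    mul := fun f g => GradedHom.comp (X := X) (Y := X) (Z := X) g f
    one := GradedHom.id X
    mul_assoc := fun f g h => (GradedHom.comp_assoc h g f).symm
    one_mul := fun f => GradedHom.comp_id f
    mul_one := fun f => GradedHom.id_comp f
    left_distrib := fun f g h =>
      DFunLike.congr_fun (map_add (GradedHom.compHom X X X) g h) f
    right_distrib := fun f g h => map_add (GradedHom.compHom X X X h) f g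
    zero_mul := fun f => map_zero (GradedHom.compHom X X X f)
    mul_zero := fun f => DFunLike.congr_fun (map_zero (GradedHom.compHom X X X)) f }

/-- `End*(X)` acts on `Hom*(X, Y)` from the right by precomposition; as usual in Mathlib, a right
module is a module over the opposite ring: `op a • f = f ∘ a`. -/
instance (X Y : C) : Module (GradedEnd X)ᵐᵒᵖ (GradedHom X Y) where
  smul a f := GradedHom.comp (X := X) (Y := X) (Z := Y) a.unop f
  one_smul f := GradedHom.id_comp f
  mul_smul a b f := GradedHom.comp_assoc (X := X) (Y := X) (Z := X) (T := Y) a.unop b.unop f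
  smul_zero a := map_zero (GradedHom.compHom X X Y a.unop)
  smul_add a f g := map_add (GradedHom.compHom X X Y a.unop) f g
  add_smul a b f := DFunLike.congr_fun (map_add (GradedHom.compHom X X Y) a.unop b.unop) f
  zero_smul f := DFunLike.congr_fun (map_zero (GradedHom.compHom X X Y)) f

/-! ### Functoriality -/

variable {E : Type u'} [Category.{v'} E] [Preadditive E] [HasShift E ℤ]
  [∀ n : ℤ, (shiftFunctor E n).Additive] (F : C ⥤ E) [F.CommShift ℤ] [F.Additive]

/-- The map `Hom*(X, Y) → Hom*(F X, F Y)` induced by an additive functor commuting with shifts. -/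
def GradedHom.map (X Y : C) : GradedHom X Y →+ GradedHom (F.obj X) (F.obj Y) :=
  GradedHom.lift fun n : ℤ => (GradedHom.of n).comp <|
    AddMonoidHom.mk' (fun f : ShiftedHom X Y n => f.map F) (fun f g => ShiftedHom.map_add f g F)

theorem GradedHom.map_of {X Y : C} (n : ℤ) (f : ShiftedHom X Y n) :
    GradedHom.map F X Y (GradedHom.of n f) = GradedHom.of n (f.map F) := by
  simp [GradedHom.map, GradedHom.lift_of]

theorem GradedHom.map_id (X : C) : GradedHom.map F X X (GradedHom.id X) = GradedHom.id (F.obj X) := by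
  simp [GradedHom.id, GradedHom.map_of]

theorem GradedHom.map_comp {X Y Z : C} (f : GradedHom X Y) (g : GradedHom Y Z) :
    GradedHom.map F X Z (f.comp g) = (GradedHom.map F X Y f).comp (GradedHom.map F Y Z g) := by
  suffices H : (AddMonoidHom.compHom (GradedHom.map F X Z)).comp (GradedHom.compHom X Y Z) =
      (AddMonoidHom.compHom.flip (GradedHom.map F Y Z)).comp
        ((GradedHom.compHom (F.obj X) (F.obj Y) (F.obj Z)).comp (GradedHom.map F X Y)) from
    DFunLike.congr_fun (DFunLike.congr_fun H f) g
  apply GradedHom.hom_ext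
  intro a f
  apply GradedHom.hom_ext
  intro b g
  change GradedHom.map F X Z ((GradedHom.of a f).comp (GradedHom.of b g)) =
    (GradedHom.map F X Y (GradedHom.of a f)).comp (GradedHom.map F Y Z (GradedHom.of b g))
  rw [GradedHom.of_comp_of, GradedHom.map_of, GradedHom.map_of, GradedHom.map_of,
    GradedHom.of_comp_of, ShiftedHom.map_comp]

/-- The ring homomorphism `End*(X) → End*(F X)`. -/
def GradedEnd.map (X : C) : GradedEnd X →+* GradedEnd (F.obj X) where
  toFun := GradedHom.map F X X
  map_one' := GradedHom.map_id F X
  map_mul' f g := GradedHom.map_comp (X := X) (Y := X) (Z := X) F g f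
  map_zero' := _root_.map_zero (GradedHom.map F X X)
  map_add' f g := _root_.map_add (GradedHom.map F X X) f g

/-! ### The action of a ring on `Hom*(X, Y)` through a homomorphism to `End*(X)` -/

variable {H : Type w} [Ring H] {X : C} (φ : H →+* GradedEnd X)

/-- `Hom*(X, Y)` as a right `H`-module via `φ : H → End*(X)`. -/
def HomModule (_φ : H →+* GradedEnd X) (Y : C) : Type v := GradedHom X Y

instance (Y : C) : AddCommGroup (HomModule φ Y) := inferInstanceAs (AddCommGroup (GradedHom X Y))

/-- The action `f · h = f ∘ φ(h)`. -/
instance (Y : C) : Module Hᵐᵒᵖ (HomModule φ Y) :=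
  Module.compHom (GradedHom X Y) (RingHom.op φ)

/-- The grading of `Hom*(X, Y)`. -/
def HomModule.grading (Y : C) (n : ℤ) : AddSubgroup (HomModule φ Y) := GradedHom.degree X Y n

/-- The canonical map `Hom*(X, Y) → Hom*(F X, F Y)`, where `H` acts on the target via
`H → End*(X) → End*(F X)`. -/
def HomModule.map (Y : C) :
    HomModule φ Y →ₗ[Hᵐᵒᵖ] HomModule ((GradedEnd.map F X).comp φ) (F.obj Y) where
  toFun := GradedHom.map F X Y
  map_add' f g := _root_.map_add (GradedHom.map F X Y) f g
  map_smul' h f := GradedHom.map_comp (X := X) (Y := X) (Z := Y) F (φ h.unop) f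

end GradedHom

/-! ### Localization of modules over a graded commutative ring -/

section Localization

variable {H : Type w} [Ring H] (𝒜 : ℤ → AddSubgroup H) [GradedRing 𝒜]

/-- `ab = (-1)^{|a||b|} ba` for all homogeneous `a`, `b`. -/
class IsGradedCommutative : Prop where
  mul_comm : ∀ ⦃i j : ℤ⦄ ⦃a b : H⦄, a ∈ 𝒜 i → b ∈ 𝒜 j → a * b = (i * j).negOnePow • (b * a)

variable {𝒜} in
/-- The multiplicative set of denominators: the submonoid generated by the set `S` of homogeneous
elements (in the opposite ring, since it acts on right modules). -/
def denominators (S : Set (SetLike.homogeneousSubmonoid 𝒜)) : Submonoid Hᵐᵒᵖ :=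
  (Submonoid.closure ((↑) '' S : Set H)).op

variable {𝒜}

theorem isHomogeneousElem_of_mem_denominators {S : Set (SetLike.homogeneousSubmonoid 𝒜)}
    {s : Hᵐᵒᵖ} (hs : s ∈ denominators S) : SetLike.IsHomogeneousElem 𝒜 s.unop := by
  have : Submonoid.closure ((↑) '' S : Set H) ≤ SetLike.homogeneousSubmonoid 𝒜 := by
    rw [Submonoid.closure_le]
    rintro _ ⟨a, -, rfl⟩
    exact a.2
  exact this hs

theorem exists_mul_eq_mul [IsGradedCommutative 𝒜] {s : H} (hs : SetLike.IsHomogeneousElem 𝒜 s)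
    (r : H) : ∃ r', r * s = s * r' := by
  obtain ⟨d, hd⟩ := hs
  induction r using DirectSum.Decomposition.inductionOn 𝒜 with
  | zero => exact ⟨0, by simp⟩
  | @homogeneous i m =>
    exact ⟨(i * d).negOnePow • (m : H), by
      rw [IsGradedCommutative.mul_comm m.2 hd, mul_smul_comm]⟩
  | add m n hm hn =>
    obtain ⟨m', hm⟩ := hm
    obtain ⟨n', hn⟩ := hn
    exact ⟨m' + n', by rw [add_mul, hm, hn, mul_add]⟩

theorem mul_eq_zero_of_mul_eq_zero [IsGradedCommutative 𝒜] {s : H}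
    (hs : SetLike.IsHomogeneousElem 𝒜 s) {r : H} (h : s * r = 0) : r * s = 0 := by
  classical
  obtain ⟨d, hd⟩ := hs
  have h' (i : ℤ) : s * (DirectSum.decompose 𝒜 r i : H) = 0 := by
    rw [← DirectSum.coe_decompose_mul_add_of_left_mem 𝒜 hd, h]
    simp
  rw [← DirectSum.sum_support_decompose 𝒜 r, Finset.sum_mul]
  refine Finset.sum_eq_zero fun i _ => ?_
  rw [IsGradedCommutative.mul_comm (SetLike.coe_mem _) hd, h', smul_zero]

instance (S : Set (SetLike.homogeneousSubmonoid 𝒜)) [IsGradedCommutative 𝒜] :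
    OreLocalization.OreSet (denominators S) where
  ore_right_cancel r₁ r₂ s h := by
    refine ⟨s, ?_⟩
    have h' : s.1.unop * (r₁.unop - r₂.unop) = 0 := by
      rw [mul_sub, sub_eq_zero]
      exact congrArg unop h
    have := mul_eq_zero_of_mul_eq_zero (isHomogeneousElem_of_mem_denominators s.2) h'
    rw [sub_mul, sub_eq_zero] at this
    exact unop_injective this
  oreNum r s :=
    op (exists_mul_eq_mul (isHomogeneousElem_of_mem_denominators s.2) r.unop).choose
  oreDenom _ s := s
  ore_eq r s := unop_injective
    (exists_mul_eq_mul (isHomogeneousElem_of_mem_denominators s.2) r.unop).choose_spec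

variable (S : Set (SetLike.homogeneousSubmonoid 𝒜)) [IsGradedCommutative 𝒜]
  (M : Type*) [AddCommGroup M] [Module Hᵐᵒᵖ M] {N : Type*} [AddCommGroup N] [Module Hᵐᵒᵖ N]

/-- The localization `S⁻¹M` of a right `H`-module: classes of fractions `m /ₒ s`. -/
abbrev Localized : Type _ := OreLocalization (denominators S) M

/-- The canonical map `M → S⁻¹M`, `m ↦ m / 1`. -/
def Localized.mk : M →ₗ[Hᵐᵒᵖ] Localized S M where
  toFun m := OreLocalization.oreDiv m 1
  map_add' m m' := OreLocalization.add_oreDiv.symm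
  map_smul' h m := (OreLocalization.smul_oreDiv_one h m).symm

variable {M} in
/-- The map `S⁻¹f : S⁻¹M → S⁻¹N`, `m / s ↦ f m / s`. -/
def Localized.map (f : M →ₗ[Hᵐᵒᵖ] N) : Localized S M →ₗ[Hᵐᵒᵖ] Localized S N where
  toFun := OreLocalization.liftExpand (fun m s => OreLocalization.oreDiv (f m) s)
    (fun m t s ht => by
      rw [map_smul]
      exact OreLocalization.expand (f m) s t ht)
  map_add' x y := by
    induction x using OreLocalization.ind with | _ m s
    induction y using OreLocalization.ind with | _ m' s'
    obtain ⟨t, t', h, h'⟩ := OreLocalization.oreDivAddChar' m m' s s'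
    rw [h', OreLocalization.liftExpand_of, OreLocalization.liftExpand_of,
      OreLocalization.liftExpand_of, OreLocalization.oreDiv_add_char s s' t t' h]
    congr 1
    simp [Submonoid.smul_def]
  map_smul' h x := by
    induction x using OreLocalization.ind with | _ m s
    rw [← OreLocalization.oreDiv_one_smul, ← OreLocalization.oreDiv_one_smul]
    obtain ⟨t, t', h, h'⟩ := OreLocalization.oreDivSMulChar' h m 1 s
    rw [h', OreLocalization.liftExpand_of, OreLocalization.liftExpand_of]
    simp only [RingHom.id_apply]
    rw [OreLocalization.oreDiv_smul_char _ _ _ _ t t' h, map_smul]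

theorem Localized.map_oreDiv (f : M →ₗ[Hᵐᵒᵖ] N) (m : M) (s : denominators S) :
    Localized.map S f (OreLocalization.oreDiv m s) = OreLocalization.oreDiv (f m) s := rfl

/-- The canonical maps form a commutative square `S⁻¹f ∘ mk = mk ∘ f`. -/
theorem Localized.map_mk (f : M →ₗ[Hᵐᵒᵖ] N) (m : M) :
    Localized.map S f (Localized.mk S M m) = Localized.mk S N (f m) := rfl

variable {M} in
/-- The grading of `S⁻¹M` for a graded module `M`: the component of degree `n` consists of the
sums of fractions `m / s` with `m` and `s` homogeneous and `|m| - |s| = n`. -/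
def Localized.grading (ℳ : ℤ → AddSubgroup M) (n : ℤ) : AddSubgroup (Localized S M) :=
  AddSubgroup.closure
    {x | ∃ (d : ℤ) (m : M) (s : denominators S), m ∈ ℳ (n + d) ∧ (s : Hᵐᵒᵖ).unop ∈ 𝒜 d ∧
      x = OreLocalization.oreDiv m s}

end Localization

/-- A linear map between graded modules is an isomorphism of graded modules if it is bijective and
maps the component of degree `n` onto the component of degree `n`, for every `n`. -/
def IsGradedIso {R : Type*} [Ring R] {M N : Type*} [AddCommGroup M] [Module R M] [AddCommGroup N]
    [Module R N] (ℳ : ℤ → AddSubgroup M) (𝒩 : ℤ → AddSubgroup N) (f : M →ₗ[R] N) : Prop :=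
  Function.Bijective f ∧ ∀ n : ℤ, (ℳ n).map f.toAddMonoidHom = 𝒩 n

/-! ### Cofibers and Verdier quotients -/

section Triangulated

variable {C : Type u} [Category.{v} C] [Preadditive C] [HasShift C ℤ]

/-- The morphism `Σ⁻ᵈ X ⟶ X` corresponding to an element `X ⟶ Σᵈ X` of degree `d`
of `End*(X)`. -/
def desuspend {X : C} {d : ℤ} (f : ShiftedHom X X d) : X⟦-d⟧ ⟶ X :=
  f⟦-d⟧' ≫ (shiftShiftNeg X d).hom

variable [HasZeroObject C] [∀ n : ℤ, (shiftFunctor C n).Additive] [Pretriangulated C]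

/-- The cofiber `X/σ` of the component `Σ⁻ᵈ X ⟶ X` in degree `d` of `σ ∈ End*(X)` is isomorphic
to an object of `D`. -/
def CofiberMem (D : ObjectProperty C) {X : C} (σ : GradedEnd X) (d : ℤ) : Prop :=
  ∃ (Z : C) (g : X ⟶ Z) (h : Z ⟶ (X⟦-d⟧)⟦(1 : ℤ)⟧),
    Triangle.mk (desuspend (GradedHom.component d σ)) g h ∈ distTriang C ∧ D Z

variable [IsTriangulated C] (D : ObjectProperty C) [D.IsTriangulated]

/-- The Verdier quotient `C/D`: the localization of `C` with respect to the morphisms whose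
cone lies in `D`. -/
abbrev VerdierQuotient : Type _ := D.trW.Localization

/-- The quotient functor `C ⥤ C/D`. -/
abbrev quotientFunctor : C ⥤ VerdierQuotient D := D.trW.Q

end Triangulated

end CohomologicalLocalization

end

open CohomologicalLocalization

noncomputable section

namespace CohomologicalLocalization

/-! Part 1: if the cofiber of `φ σ` lies in `D`, then `Q` turns `φ σ` into an isomorphism `c ⟶ Σᵈ c`
(`isIso_map_of_cofiberMem`). Composition with it is bijective on `Hom*` in the quotient, and a
module on which every denominator acts bijectively agrees with its localization
(`HomModule.isGradedIso_mk`).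

Part 2 is the calculus of fractions together with one principle: every morphism from `c` to an
object of `D` is killed by a denominator. A morphism killed by `Q` factors through an object of `D`,
so a denominator kills it (`HomModule.mk_eq_zero_of_map_eq_zero`); this gives injectivity. A
morphism in the quotient is a fraction `w⁻¹u` with the cone `y` of `w` in `D`. The obstruction to
lifting `u` through `w` is a morphism `c ⟶ y`; a denominator kills it, so a multiple of the fraction
comes from `C` (`HomModule.exists_smul_eq_map`); this gives surjectivity. -/

theorem ShiftedHom.comp_bijective_of_isIso {C : Type u} [Category.{v} C] [HasShift C ℤ]
    {X Y Z : C} {d : ℤ} (g : X ⟶ Y⟦d⟧)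
    [IsIso g] (n : ℤ) :
    Function.Bijective
      (fun f : ShiftedHom Y Z n => ShiftedHom.comp (show ShiftedHom X Y d from g) f rfl) := by
  have h₁ : Function.Bijective (fun f : Y ⟶ Z⟦n⟧ => f⟦d⟧') :=
    ⟨(shiftFunctor C d).map_injective, (shiftFunctor C d).map_surjective⟩
  have h₂ : Function.Bijective (fun f : Y⟦d⟧ ⟶ Z⟦n⟧⟦d⟧ =>
      g ≫ f ≫ (shiftFunctorAdd' C n d (n + d) rfl).inv.app Z) := by
    refine ⟨fun a b h => (cancel_mono _).1 ((cancel_epi g).1 h), fun b =>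
      ⟨inv g ≫ b ≫ (shiftFunctorAdd' C n d (n + d) rfl).hom.app Z, by simp⟩⟩
  exact h₂.comp h₁

/-! ### Calculus in graded Hom groups -/

section GradedHom

variable {C : Type u} [Category.{v} C] [Preadditive C] [HasShift C ℤ]

theorem GradedHom.induction_on {X Y : C} {p : GradedHom X Y → Prop} (f : GradedHom X Y)
    (zero : p 0) (of : ∀ (n : ℤ) (f : ShiftedHom X Y n), p (GradedHom.of n f))
    (add : ∀ f g, p f → p g → p (f + g)) : p f :=
  DirectSum.induction_on (motive := p) f zero of add

/-- The component of degree `n`, as an additive map. -/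
def GradedHom.componentHom (X Y : C) (n : ℤ) : GradedHom X Y →+ ShiftedHom X Y n :=
  DFinsupp.evalAddMonoidHom (β := fun n : ℤ => ShiftedHom X Y n) n

theorem GradedHom.componentHom_of_self {X Y : C} (n : ℤ) (f : ShiftedHom X Y n) :
    GradedHom.componentHom X Y n (GradedHom.of n f) = f :=
  DirectSum.of_eq_same (β := fun n : ℤ => ShiftedHom X Y n) n f

theorem GradedHom.componentHom_of_of_ne {X Y : C} {m n : ℤ} (h : m ≠ n) (f : ShiftedHom X Y m) :
    GradedHom.componentHom X Y n (GradedHom.of m f) = 0 :=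
  DirectSum.of_eq_of_ne (β := fun n : ℤ => ShiftedHom X Y n) m n f h.symm

theorem GradedHom.eq_zero_of_componentHom {X Y : C} {f : GradedHom X Y}
    (h : ∀ n, GradedHom.componentHom X Y n f = 0) : f = 0 :=
  DFinsupp.ext (β := fun n : ℤ => ShiftedHom X Y n) h

theorem GradedHom.component_of_self {X Y : C} (n : ℤ) (f : ShiftedHom X Y n) :
    GradedHom.component n (GradedHom.of n f) = f :=
  GradedHom.componentHom_of_self n f

theorem GradedHom.exists_eq_sum {X Y : C} (f : GradedHom X Y) :
    ∃ s : Finset ℤ, f = ∑ n ∈ s, GradedHom.of n (GradedHom.componentHom X Y n f) := by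
  classical
  exact ⟨_, (DirectSum.sum_support_of (β := fun n : ℤ => ShiftedHom X Y n) f).symm⟩

/-- A morphism `X ⟶ Y` as an element of `Hom*(X, Y)`. -/
def GradedHom.ofHom {X Y : C} (f : X ⟶ Y) : GradedHom X Y :=
  GradedHom.of 0 (ShiftedHom.mk₀ 0 rfl f)

/-- The tautological element of degree `n` in `Hom*(Σⁿ X, X)`. -/
def GradedHom.shiftSelf (X : C) (n : ℤ) : GradedHom (X⟦n⟧) X :=
  GradedHom.of n (𝟙 (X⟦n⟧) : ShiftedHom (X⟦n⟧) X n)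

variable [∀ n : ℤ, (shiftFunctor C n).Additive]

theorem GradedHom.comp_add {X Y Z : C} (f : GradedHom X Y) (g g' : GradedHom Y Z) :
    f.comp (g + g') = f.comp g + f.comp g' := by
  simp [GradedHom.comp]

theorem GradedHom.zero_comp {X Y Z : C} (g : GradedHom Y Z) :
    (0 : GradedHom X Y).comp g = 0 := by
  simp [GradedHom.comp]

theorem GradedHom.comp_zero {X Y Z : C} (f : GradedHom X Y) :
    f.comp (0 : GradedHom Y Z) = 0 := by
  simp [GradedHom.comp]

theorem GradedHom.ofHom_comp_of {X Y Z : C} {n : ℤ} (f : X ⟶ Y) (g : ShiftedHom Y Z n) :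
    (GradedHom.ofHom f).comp (GradedHom.of n g) = GradedHom.of n (f ≫ g : X ⟶ Z⟦n⟧) := by
  rw [GradedHom.ofHom, GradedHom.of_comp_of' _ _ (add_zero n), ShiftedHom.mk₀_comp]

theorem GradedHom.of_comp_ofHom {X Y Z : C} {n : ℤ} (f : ShiftedHom X Y n) (g : Y ⟶ Z) :
    (GradedHom.of n f).comp (GradedHom.ofHom g) = GradedHom.of n (f ≫ g⟦n⟧' : X ⟶ Z⟦n⟧) := by
  rw [GradedHom.ofHom, GradedHom.of_comp_of' _ _ (zero_add n), ShiftedHom.comp_mk₀]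

theorem GradedHom.ofHom_comp_ofHom {X Y Z : C} (f : X ⟶ Y) (g : Y ⟶ Z) :
    (GradedHom.ofHom f).comp (GradedHom.ofHom g) = GradedHom.ofHom (f ≫ g) := by
  rw [GradedHom.ofHom, GradedHom.ofHom, GradedHom.of_comp_of' _ _ (zero_add 0),
    ShiftedHom.mk₀_comp_mk₀, GradedHom.ofHom]

/-- Elements of degree `n` thus become genuine morphisms into `Σⁿ Y`, to which triangles and
fractions apply. -/
theorem GradedHom.ofHom_comp_shiftSelf {X Y : C} {n : ℤ} (f : X ⟶ Y⟦n⟧) :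
    (GradedHom.ofHom f).comp (GradedHom.shiftSelf Y n) = GradedHom.of n f := by
  rw [GradedHom.shiftSelf, GradedHom.ofHom_comp_of, Category.comp_id]

theorem GradedHom.comp_mem_degree {X Y Z : C} {a b : ℤ} {f : GradedHom X Y} {g : GradedHom Y Z}
    (hf : f ∈ GradedHom.degree X Y a) (hg : g ∈ GradedHom.degree Y Z b) :
    f.comp g ∈ GradedHom.degree X Z (b + a) := by
  obtain ⟨f, rfl⟩ := hf
  obtain ⟨g, rfl⟩ := hg
  rw [GradedHom.of_comp_of]
  exact ⟨_, rfl⟩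

theorem GradedHom.comp_ofHom_cancel {X Y Z : C} {f g : GradedHom X Y} (w : Y ⟶ Z) [IsIso w]
    (h : f.comp (GradedHom.ofHom w) = g.comp (GradedHom.ofHom w)) : f = g := by
  have := congrArg (fun k => k.comp (GradedHom.ofHom (inv w))) h
  simp only [GradedHom.comp_assoc, GradedHom.ofHom_comp_ofHom, IsIso.hom_inv_id] at this
  exact (GradedHom.comp_id f).symm.trans (this.trans (GradedHom.comp_id g))

theorem GradedHom.componentHom_of_comp {X Y Z : C} {d : ℤ} (g : ShiftedHom X Y d)
    (f : GradedHom Y Z) (n : ℤ) :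
    GradedHom.componentHom X Z (n + d) ((GradedHom.of d g).comp f) =
      g.comp (GradedHom.componentHom Y Z n f) rfl := by
  induction f using GradedHom.induction_on with
  | zero => simp [GradedHom.comp_zero]
  | of k f =>
    rw [GradedHom.of_comp_of]
    by_cases h : k = n
    · subst h
      rw [GradedHom.componentHom_of_self, GradedHom.componentHom_of_self]
    · rw [GradedHom.componentHom_of_of_ne h, GradedHom.componentHom_of_of_ne (by simpa using h),
        ShiftedHom.comp_zero]
  | add f f' hf hf' => rw [GradedHom.comp_add, map_add, hf, hf', map_add, ShiftedHom.comp_add]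

/-- Composition with `g` raises every degree by exactly `d`, so injectivity is checked on components
and surjectivity on homogeneous elements. -/
theorem GradedHom.of_comp_bijective_of_isIso {X Y Z : C} {d : ℤ} (g : X ⟶ Y⟦d⟧) [IsIso g] :
    Function.Bijective (fun f : GradedHom Y Z => (GradedHom.of d g).comp f) := by
  constructor
  · change Function.Injective (GradedHom.compHom X Y Z (GradedHom.of d g))
    rw [injective_iff_map_eq_zero]
    intro f hf
    refine GradedHom.eq_zero_of_componentHom fun n =>
      (ShiftedHom.comp_bijective_of_isIso g n).1 ?_
    simp only [ShiftedHom.comp_zero]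
    rw [← GradedHom.componentHom_of_comp]
    exact (congrArg _ hf).trans (map_zero _)
  · intro f
    induction f using GradedHom.induction_on with
    | zero => exact ⟨0, GradedHom.comp_zero _⟩
    | of n f =>
      obtain ⟨k, rfl⟩ : ∃ k, n = k + d := ⟨n - d, by simp⟩
      obtain ⟨f, rfl⟩ := (ShiftedHom.comp_bijective_of_isIso g k).2 f
      exact ⟨GradedHom.of k f, GradedHom.of_comp_of _ _⟩
    | add f f' hf hf' =>
      obtain ⟨a, rfl⟩ := hf
      obtain ⟨b, rfl⟩ := hf'
      exact ⟨a + b, GradedHom.comp_add _ _ _⟩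

/-- If `f ∘ g` is homogeneous of degree `n + d`, with `g` of degree `d`, then `f` may be replaced by
its component of degree `n`. -/
theorem GradedHom.of_comp_componentHom {X Y Z : C} {d n : ℤ} (g : ShiftedHom X Y d)
    {f : GradedHom Y Z} (h : (GradedHom.of d g).comp f ∈ GradedHom.degree X Z (n + d)) :
    (GradedHom.of d g).comp (GradedHom.of n (GradedHom.componentHom Y Z n f)) =
      (GradedHom.of d g).comp f := by
  obtain ⟨k, hk⟩ := h
  rw [GradedHom.of_comp_of, ← GradedHom.componentHom_of_comp, ← hk,
    GradedHom.componentHom_of_self]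

/-! ### Functors on graded Hom groups -/

section Functoriality

variable {E : Type u'} [Category.{v'} E] [Preadditive E] [HasShift E ℤ]
  [∀ n : ℤ, (shiftFunctor E n).Additive] (F : C ⥤ E) [F.CommShift ℤ] [F.Additive]

theorem GradedHom.map_ofHom {X Y : C} (f : X ⟶ Y) :
    GradedHom.map F X Y (GradedHom.ofHom f) = GradedHom.ofHom (F.map f) := by
  rw [GradedHom.ofHom, GradedHom.map_of, ShiftedHom.map_mk₀, GradedHom.ofHom]

theorem GradedHom.map_mem_degree {X Y : C} {n : ℤ} {f : GradedHom X Y}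
    (hf : f ∈ GradedHom.degree X Y n) :
    GradedHom.map F X Y f ∈ GradedHom.degree (F.obj X) (F.obj Y) n := by
  obtain ⟨f, rfl⟩ := hf
  exact ⟨f.map F, (GradedHom.map_of F n f).symm⟩

theorem GradedHom.componentHom_map {X Y : C} (f : GradedHom X Y) (n : ℤ) :
    GradedHom.componentHom (F.obj X) (F.obj Y) n (GradedHom.map F X Y f) =
      ShiftedHom.map (GradedHom.componentHom X Y n f) F := by
  induction f using GradedHom.induction_on with
  | zero => simp
  | of k f =>
    rw [GradedHom.map_of]
    by_cases h : k = n
    · subst h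
      rw [GradedHom.componentHom_of_self, GradedHom.componentHom_of_self]
    · rw [GradedHom.componentHom_of_of_ne h, GradedHom.componentHom_of_of_ne h,
        ShiftedHom.map_zero]
  | add f f' hf hf' => rw [map_add, map_add, hf, hf', map_add, ShiftedHom.map_add]

/-- Every homogeneous element of `Hom*(F X, F Y)` comes from a morphism `F X ⟶ F (Σⁿ Y)`. -/
theorem GradedHom.exists_ofHom_comp_map_shiftSelf {X Y : C} {n : ℤ}
    (f : ShiftedHom (F.obj X) (F.obj Y) n) :
    ∃ q : F.obj X ⟶ F.obj (Y⟦n⟧), GradedHom.of n f =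
      (GradedHom.ofHom q).comp (GradedHom.map F _ _ (GradedHom.shiftSelf Y n)) := by
  refine ⟨f ≫ (F.commShiftIso n).inv.app Y, ?_⟩
  rw [GradedHom.shiftSelf, GradedHom.map_of, GradedHom.ofHom_comp_of]
  congr 1
  simp [ShiftedHom.map]

end Functoriality

end GradedHom

/-! ### Torsion and bijectivity in Ore localizations -/

section Localization

variable {H : Type w} [Ring H] {𝒜 : ℤ → AddSubgroup H} [GradedRing 𝒜]
  {S : Set (SetLike.homogeneousSubmonoid 𝒜)}
  {M : Type*} [AddCommGroup M] [Module Hᵐᵒᵖ M] {N : Type*} [AddCommGroup N] [Module Hᵐᵒᵖ N]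

theorem denominators_smul_bijective
    (h : ∀ σ ∈ S, Function.Bijective (fun m : M => op (σ : H) • m)) (s : denominators S) :
    Function.Bijective (fun m : M => s • m) := by
  obtain ⟨s, hs⟩ := s
  suffices ∀ a ∈ Submonoid.closure ((↑) '' S : Set H),
      Function.Bijective (fun m : M => op a • m) from this s.unop hs
  intro a ha
  induction ha using Submonoid.closure_induction with
  | mem x hx =>
    obtain ⟨σ, hσ, rfl⟩ := hx
    exact h σ hσ
  | one => simpa using! Function.bijective_id
  | mul x y _ _ hx hy => simpa [Function.comp_def, mul_smul] using hy.comp hx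

variable [IsGradedCommutative 𝒜]

theorem Localized.oreDiv_eq_zero_iff (m : M) (s : denominators S) :
    (OreLocalization.oreDiv m s : Localized S M) = 0 ↔ ∃ t : denominators S, t • m = 0 := by
  constructor
  · intro h
    rw [OreLocalization.zero_def, eq_comm, OreLocalization.oreDiv_eq_iff] at h
    obtain ⟨u, v, h, -⟩ := h
    exact ⟨u, by rw [h, smul_zero]⟩
  · rintro ⟨t, ht⟩
    rw [OreLocalization.expand' m s t, ht, OreLocalization.zero_oreDiv]

theorem Localized.mk_eq_zero_iff (m : M) :
    Localized.mk S M m = 0 ↔ ∃ t : denominators S, t • m = 0 :=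
  Localized.oreDiv_eq_zero_iff m 1

/-- If `f m / s = 0`, some `t` moves `m` into the kernel of `f`, and a further `u` kills `t • m`. -/
theorem Localized.map_injective_of_ker (f : M →ₗ[Hᵐᵒᵖ] N)
    (h : ∀ m, f m = 0 → Localized.mk S M m = 0) :
    Function.Injective (Localized.map S f) := by
  rw [injective_iff_map_eq_zero]
  intro x hx
  induction x using OreLocalization.ind with | _ m s
  rw [Localized.map_oreDiv, Localized.oreDiv_eq_zero_iff] at hx
  obtain ⟨t, ht⟩ := hx
  rw [Submonoid.smul_def, ← map_smul] at ht
  obtain ⟨u, hu⟩ := (Localized.mk_eq_zero_iff _).1 (h _ ht)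
  rw [Localized.oreDiv_eq_zero_iff]
  exact ⟨u * t, by rw [mul_smul]; exact hu⟩

theorem Localized.bijective_mk (h : ∀ s : denominators S, Function.Bijective (fun m : M => s • m)) :
    Function.Bijective (Localized.mk S M) := by
  constructor
  · rw [injective_iff_map_eq_zero]
    intro m hm
    obtain ⟨t, ht⟩ := (Localized.mk_eq_zero_iff m).1 hm
    exact (h t).1 (ht.trans (smul_zero t).symm)
  · intro x
    induction x using OreLocalization.ind with | _ m s
    obtain ⟨m, rfl⟩ := (h s).2 m
    refine ⟨m, ?_⟩
    exact (OreLocalization.expand' m 1 s).trans (by rw [mul_one])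

end Localization

/-! ### Denominators acting by isomorphisms -/

section Action

variable {C : Type u} [Category.{v} C] [Preadditive C] [HasShift C ℤ]
  [∀ n : ℤ, (shiftFunctor C n).Additive]
  {H : Type w} [Ring H] {𝒜 : ℤ → AddSubgroup H} [GradedRing 𝒜]
  {S : Set (SetLike.homogeneousSubmonoid 𝒜)} {c : C} {φ : H →+* GradedEnd c}

theorem HomModule.smul_eq_comp {x : C} (s : denominators S) (m : HomModule φ x) :
    s • m = GradedHom.comp (X := c) (Y := c) (Z := x) (φ (s : Hᵐᵒᵖ).unop) m :=
  rfl

variable [IsGradedCommutative 𝒜]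

theorem HomModule.exists_smul_eq_zero {y : C} [Subsingleton (Localized S (HomModule φ y))]
    (f : HomModule φ y) : ∃ s : denominators S, s • f = 0 :=
  (Localized.mk_eq_zero_iff f).1 (Subsingleton.elim _ _)

theorem HomModule.isGradedIso_mk (hφ : ∀ (n : ℤ), ∀ a ∈ 𝒜 n, φ a ∈ GradedHom.degree c c n)
    (hS : ∀ σ ∈ S, ∃ (d : ℤ) (g : ShiftedHom c c d), IsIso g ∧ φ (σ : H) = GradedHom.of d g)
    (x : C) :
    IsGradedIso (HomModule.grading φ x) (Localized.grading S (HomModule.grading φ x))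
      (Localized.mk S (HomModule φ x)) := by
  have hb : ∀ s : denominators S, Function.Bijective (fun m : HomModule φ x => s • m) := by
    refine denominators_smul_bijective fun σ hσ => ?_
    obtain ⟨d, g, hg, hσ⟩ := hS σ hσ
    have := GradedHom.of_comp_bijective_of_isIso (Z := x) g
    rw [← hσ] at this
    exact this
  refine ⟨Localized.bijective_mk hb, fun n => le_antisymm ?_ ?_⟩
  · rintro _ ⟨m, hm, rfl⟩
    exact AddSubgroup.subset_closure
      ⟨0, m, 1, by rwa [add_zero], SetLike.GradedOne.one_mem, rfl⟩
  · refine (AddSubgroup.closure_le _).2 ?_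
    rintro _ ⟨d, m, s, hm, hs, rfl⟩
    obtain ⟨m, rfl⟩ := (hb s).2 m
    obtain ⟨g, hg⟩ := hφ d _ hs
    -- The preimage `m` is not known to be homogeneous, but `s • m` has degree `n + d`, so only the
    -- component of `m` in degree `n` contributes.
    let m' : HomModule φ x := GradedHom.of n (GradedHom.componentHom c x n m)
    have hm' : s • m' = s • m := by
      rw [HomModule.smul_eq_comp, HomModule.smul_eq_comp, ← hg]
      refine GradedHom.of_comp_componentHom g ?_
      rw [hg]
      exact hm
    refine ⟨m', ⟨_, rfl⟩, ?_⟩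
    change OreLocalization.oreDiv m' 1 = OreLocalization.oreDiv (s • m) s
    rw [← hm', OreLocalization.expand' m' 1 s, mul_one]

end Action

/-! ### Triangles and the Verdier quotient -/

section Triangulated

variable {C : Type u} [Category.{v} C] [Preadditive C] [HasZeroObject C] [HasShift C ℤ]
  [∀ n : ℤ, (shiftFunctor C n).Additive] [Pretriangulated C]

/-- The `d`-fold shift of a triangle is distinguished only with signs `(-1)ᵈ` on its maps; the sign
is absorbed into the lift. -/
theorem exists_comp_shift_eq_of_distTriang {X x z y : C} {w : x ⟶ z} {q : z ⟶ y}
    {r : y ⟶ x⟦(1 : ℤ)⟧} (hT : Triangle.mk w q r ∈ distTriang C) (d : ℤ) (f : X ⟶ z⟦d⟧)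
    (hf : f ≫ q⟦d⟧' = 0) : ∃ b : X ⟶ x⟦d⟧, b ≫ w⟦d⟧' = f := by
  obtain ⟨b, hb⟩ : ∃ b : X ⟶ x⟦d⟧, f = b ≫ (d.negOnePow • w⟦d⟧') :=
    Triangle.coyoneda_exact₂ _ (Triangle.shift_distinguished _ hT d) f
    (by
      change f ≫ (d.negOnePow • q⟦d⟧') = 0
      rw [Linear.comp_units_smul, hf, smul_zero])
  refine ⟨d.negOnePow • b, ?_⟩
  rw [hb, Linear.units_smul_comp, Linear.comp_units_smul]

variable (D : ObjectProperty C) [D.IsTriangulated]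

/-- Up to an isomorphism, `desuspend g` is a shift of `g`, and `D.trW` is stable under both, so `Q`
inverts `g` itself. -/
theorem isIso_map_of_cofiberMem {c : C} {d : ℤ} {g : ShiftedHom c c d}
    (h : CofiberMem D (GradedHom.of d g : GradedHom c c) d) :
    IsIso (g.map (quotientFunctor D)) := by
  obtain ⟨Z, p, q, hT, hZ⟩ := h
  rw [GradedHom.component_of_self] at hT
  have h₁ : D.trW (desuspend g) := ⟨Z, p, q, hT, hZ⟩
  have h₂ : D.trW (g⟦-d⟧') := (MorphismProperty.cancel_right_of_respectsIso _ _ _).1 h₁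
  have := Localization.inverts (quotientFunctor D) D.trW _ h₂.unshift
  exact inferInstanceAs (IsIso (_ ≫ _))

variable [IsTriangulated C] {H : Type w} [Ring H] {𝒜 : ℤ → AddSubgroup H} [GradedRing 𝒜]
  [IsGradedCommutative 𝒜]
  {S : Set (SetLike.homogeneousSubmonoid 𝒜)} {c : C} {φ : H →+* GradedEnd c}

/-- An element of `Hom*(c, x)` vanishing in the Verdier quotient vanishes in the localization. -/
theorem HomModule.mk_eq_zero_of_map_eq_zero
    (hD : ∀ y : C, D y → Subsingleton (Localized S (HomModule φ y))) {x : C} (m : HomModule φ x)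
    (hm : HomModule.map (quotientFunctor D) φ x m = 0) :
    Localized.mk S (HomModule φ x) m = 0 := by
  have hof (n : ℤ) (f : c ⟶ x⟦n⟧) (hf : (quotientFunctor D).map f = 0) :
      Localized.mk S (HomModule φ x) (GradedHom.of n f : GradedHom c x) = 0 := by
    -- Some `w` with cone in `D` annihilates `f`; in the triangle that has `w` as its second map,
    -- `f` factors through the first term `y`, an object of `D`.
    obtain ⟨z, w, hw, hfw⟩ :=
      (MorphismProperty.map_eq_iff_postcomp (quotientFunctor D) D.trW f 0).1 (by simp [hf])
    obtain ⟨y, β, r, hT, hy⟩ := (D.trW_iff' w).1 hw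
    obtain ⟨α, hα⟩ : ∃ α : c ⟶ y, f = α ≫ β :=
      Triangle.coyoneda_exact₂ _ hT f (hfw.trans Limits.zero_comp)
    have := hD y hy
    obtain ⟨s, hs⟩ := HomModule.exists_smul_eq_zero (S := S) (φ := φ) (y := y)
      (GradedHom.ofHom α)
    replace hs := (HomModule.smul_eq_comp s _).symm.trans hs
    refine (Localized.mk_eq_zero_iff _).2 ⟨s, (HomModule.smul_eq_comp s _).trans ?_⟩
    -- Denominators act by precomposition, so one that kills `α` kills everything factoring through
    -- it.
    have hf' : GradedHom.of n f =
        (GradedHom.ofHom α).comp ((GradedHom.ofHom β).comp (GradedHom.shiftSelf x n)) := by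
      rw [← GradedHom.comp_assoc, GradedHom.ofHom_comp_ofHom, GradedHom.ofHom_comp_shiftSelf]
      rw [hα]
    rw [hf']
    exact (GradedHom.comp_assoc _ _ _).symm.trans
      ((congrArg (fun k : GradedHom c y => k.comp _) hs).trans (GradedHom.zero_comp _))
  obtain ⟨s, hs⟩ := GradedHom.exists_eq_sum m
  rw [hs]
  refine (map_sum (Localized.mk S (HomModule φ x)) _ _).trans
    (Finset.sum_eq_zero fun n _ => hof n _ ?_)
  -- Vanishing passes to each component, and the isomorphism `Q Σⁿ ≅ Σⁿ Q` can be cancelled.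
  have h := GradedHom.componentHom_map (quotientFunctor D) m n
  rw [show GradedHom.map (quotientFunctor D) c x m = 0 from hm, map_zero] at h
  exact (cancel_mono (((quotientFunctor D).commShiftIso n).hom.app x)).1
    (h.symm.trans Limits.zero_comp.symm)

/-- Every homogeneous element of `Hom*` in the Verdier quotient has a multiple by a denominator
that comes from a homogeneous element of `Hom*` in the triangulated category. -/
theorem HomModule.exists_smul_eq_map
    (hφ : ∀ (n : ℤ), ∀ a ∈ 𝒜 n, φ a ∈ GradedHom.degree c c n)
    (hD : ∀ y : C, D y → Subsingleton (Localized S (HomModule φ y))) {x : C} {n : ℤ}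
    {m : HomModule ((GradedEnd.map (quotientFunctor D) c).comp φ) ((quotientFunctor D).obj x)}
    (hm : m ∈ HomModule.grading _ _ n) :
    ∃ (t : denominators S) (e : ℤ) (m' : HomModule φ x), (t : Hᵐᵒᵖ).unop ∈ 𝒜 e ∧
      m' ∈ HomModule.grading φ x (n + e) ∧
      t • m = HomModule.map (quotientFunctor D) φ x m' := by
  obtain ⟨f, rfl⟩ := hm
  obtain ⟨p, hp⟩ := GradedHom.exists_ofHom_comp_map_shiftSelf (quotientFunctor D) f
  obtain ⟨ψ, hψ⟩ := Localization.exists_leftFraction (quotientFunctor D) D.trW p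
  have hpw : p ≫ (quotientFunctor D).map ψ.s = (quotientFunctor D).map ψ.f := by
    rw [hψ, MorphismProperty.LeftFraction.map_comp_map_s]
  have hw := Localization.inverts (quotientFunctor D) D.trW _ ψ.hs
  obtain ⟨y, v, r, hT, hy⟩ := ψ.hs
  have := hD y hy
  -- The composite `ψ.f ≫ v` into the cone of `ψ.s` is the obstruction to lifting `ψ.f` through
  -- `ψ.s`; after multiplication by `t` it vanishes, and `b` below is the lift.
  obtain ⟨t, ht⟩ := HomModule.exists_smul_eq_zero (S := S) (φ := φ) (y := y)
    (GradedHom.ofHom (ψ.f ≫ v))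
  replace ht := (HomModule.smul_eq_comp t _).symm.trans ht
  obtain ⟨d, hd⟩ := isHomogeneousElem_of_mem_denominators t.2
  obtain ⟨g, hg⟩ := hφ d _ hd
  rw [← hg, ← GradedHom.ofHom_comp_ofHom, ← GradedHom.comp_assoc, GradedHom.of_comp_ofHom,
    GradedHom.of_comp_ofHom] at ht
  obtain ⟨b, hb⟩ := exists_comp_shift_eq_of_distTriang hT d (g ≫ ψ.f⟦d⟧') (by
    have := congrArg (GradedHom.componentHom c y d) ht
    rw [GradedHom.componentHom_of_self] at this
    exact this.trans (map_zero (GradedHom.componentHom c y d)))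
  have hb' : (GradedHom.of d b).comp (GradedHom.ofHom ψ.s) =
      (GradedHom.of d g).comp (GradedHom.ofHom ψ.f) := by
    rw [GradedHom.of_comp_ofHom, GradedHom.of_comp_ofHom, hb]
  -- In the quotient `ψ.s` is invertible, so the lift `b` agrees there with the multiple of `p` by
  -- `t`.
  have hbq : (GradedHom.map (quotientFunctor D) _ _ (GradedHom.of d g)).comp
      (GradedHom.ofHom p) = GradedHom.map (quotientFunctor D) _ _ (GradedHom.of d b) := by
    refine GradedHom.comp_ofHom_cancel ((quotientFunctor D).map ψ.s) ?_
    rw [GradedHom.comp_assoc, GradedHom.ofHom_comp_ofHom, hpw, ← GradedHom.map_ofHom,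
      ← GradedHom.map_ofHom, ← GradedHom.map_comp, ← GradedHom.map_comp, hb']
  refine ⟨t, d, (GradedHom.of d b).comp (GradedHom.shiftSelf x n), hd,
    GradedHom.comp_mem_degree ⟨b, rfl⟩ ⟨_, rfl⟩, ?_⟩
  change GradedHom.comp (GradedHom.map (quotientFunctor D) c c (φ (t : Hᵐᵒᵖ).unop))
    (GradedHom.of n f) = GradedHom.map (quotientFunctor D) c x
      ((GradedHom.of d b).comp (GradedHom.shiftSelf x n))
  rw [← hg, hp, ← GradedHom.comp_assoc, hbq, GradedHom.map_comp]

theorem HomModule.isGradedIso_localizedMap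
    (hφ : ∀ (n : ℤ), ∀ a ∈ 𝒜 n, φ a ∈ GradedHom.degree c c n)
    (hD : ∀ y : C, D y → Subsingleton (Localized S (HomModule φ y))) (x : C) :
    IsGradedIso (Localized.grading S (HomModule.grading φ x))
      (Localized.grading S (HomModule.grading ((GradedEnd.map (quotientFunctor D) c).comp φ)
        ((quotientFunctor D).obj x)))
      (Localized.map S (HomModule.map (quotientFunctor D) φ x)) := by
  -- Expand `m / s = (t • m) / (t * s)`, with `t` chosen so that `t • m` comes from `C`.
  have key {n : ℤ}
      {m : HomModule ((GradedEnd.map (quotientFunctor D) c).comp φ) ((quotientFunctor D).obj x)}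
      (hm : m ∈ HomModule.grading _ _ n) (s : denominators S) :
      ∃ (t : denominators S) (e : ℤ) (m' : HomModule φ x), (t : Hᵐᵒᵖ).unop ∈ 𝒜 e ∧
        m' ∈ HomModule.grading φ x (n + e) ∧ Localized.map S
          (HomModule.map (quotientFunctor D) φ x) (OreLocalization.oreDiv m' (t * s)) =
          OreLocalization.oreDiv m s := by
    obtain ⟨t, e, m', ht, hm', h⟩ := HomModule.exists_smul_eq_map D hφ hD hm
    exact ⟨t, e, m', ht, hm', by
      rw [Localized.map_oreDiv, ← h, ← OreLocalization.expand']⟩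
  refine ⟨⟨Localized.map_injective_of_ker _ (HomModule.mk_eq_zero_of_map_eq_zero D hD), ?_⟩,
    fun n => le_antisymm ?_ ?_⟩
  · intro z
    induction z using OreLocalization.ind with | _ m s
    -- Keeping `s` fixed lets fractions with homogeneous numerators be added over a common
    -- denominator.
    induction m using GradedHom.induction_on with
    | zero => exact ⟨0, by rw [map_zero]; exact (OreLocalization.zero_oreDiv s).symm⟩
    | of n f =>
      obtain ⟨t, e, m', -, -, h⟩ := key ⟨f, rfl⟩ s
      exact ⟨_, h⟩
    | add f f' hf hf' =>
      obtain ⟨a, ha⟩ := hf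
      obtain ⟨b, hb⟩ := hf'
      exact ⟨a + b, by rw [map_add, ha, hb]; exact OreLocalization.add_oreDiv⟩
  · rw [AddSubgroup.map_le_iff_le_comap]
    refine (AddSubgroup.closure_le _).2 ?_
    rintro _ ⟨d, m, s, hm, hs, rfl⟩
    exact AddSubgroup.subset_closure
      ⟨d, _, s, GradedHom.map_mem_degree (quotientFunctor D) hm, hs, rfl⟩
  · refine (AddSubgroup.closure_le _).2 ?_
    rintro _ ⟨d, m, s, hm, hs, rfl⟩
    obtain ⟨t, e, m', ht, hm', h⟩ := key hm s
    refine ⟨_, AddSubgroup.subset_closure ⟨d + e, m', t * s, ?_, ?_, rfl⟩, h⟩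
    · rwa [← add_assoc]
    -- The product `t * s` is taken in the opposite ring, so in `H` the factor from `s` comes first.
    · exact SetLike.GradedMul.mul_mem hs ht

end Triangulated

end CohomologicalLocalization

end


theorem mainTheorem11
    -- a triangulated category and a full triangulated subcategory
    {C : Type u} [Category.{v} C] [Preadditive C] [HasZeroObject C] [HasShift C ℤ]
    [∀ n : ℤ, (shiftFunctor C n).Additive] [Pretriangulated C] [IsTriangulated C]
    (D : ObjectProperty C) [D.IsTriangulated]
    -- a graded commutative ring and a graded ring homomorphism to `End*(c)`
    {H : Type w} [Ring H] (𝒜 : ℤ → AddSubgroup H) [GradedRing 𝒜] [IsGradedCommutative 𝒜]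
    (c : C) (φ : H →+* GradedEnd c)
    (hφ : ∀ (n : ℤ), ∀ a ∈ 𝒜 n, φ a ∈ GradedHom.degree c c n)
    -- a set of homogeneous elements
    (S : Set (SetLike.homogeneousSubmonoid 𝒜)) :
    -- part 1: the map `ν`
    ((∀ σ ∈ S, ∃ d : ℤ, (σ : H) ∈ 𝒜 d ∧ CofiberMem D (φ σ) d) →
      ∀ x : C,
        letI φQ := (GradedEnd.map (quotientFunctor D) c).comp φ
        letI Qx := (quotientFunctor D).obj x
        IsGradedIso (HomModule.grading φQ Qx) (Localized.grading S (HomModule.grading φQ Qx))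
          (Localized.mk S (HomModule φQ Qx))) ∧
    -- part 2: the map `S⁻¹π`
    ((∀ y : C, D y → Subsingleton (Localized S (HomModule φ y))) →
      ∀ x : C,
        letI φQ := (GradedEnd.map (quotientFunctor D) c).comp φ
        letI Qx := (quotientFunctor D).obj x
        IsGradedIso (Localized.grading S (HomModule.grading φ x))
          (Localized.grading S (HomModule.grading φQ Qx))
          (Localized.map S (HomModule.map (quotientFunctor D) φ x))) := by
  refine ⟨fun hS x => ?_, fun hD x => HomModule.isGradedIso_localizedMap D hφ hD x⟩
  refine HomModule.isGradedIso_mk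
    (fun n a ha => GradedHom.map_mem_degree (quotientFunctor D) (hφ n a ha)) (fun σ hσ => ?_) _
  obtain ⟨d, hd, h⟩ := hS σ hσ
  -- As `φ σ` is homogeneous of degree `d`, the component whose cofiber is taken is all of `φ σ`.
  obtain ⟨g, hg⟩ := hφ d _ hd
  rw [← hg] at h
  exact ⟨d, _, isIso_map_of_cofiberMem D h,
    (congrArg (GradedHom.map (quotientFunctor D) c c) hg).symm.trans (GradedHom.map_of _ _ _)⟩
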